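/- Let $G=\mathrm{SL}(2,\mathbb{R})$, $\Gamma=\mathrm{SL}(2,\mathbb{Z})$, $\mathbb{T}=\mathbb{R}/\mathbb{Z}$ and $e(x)=\mathrm{e}^{2\pi \mathrm{i} x}$. For $f\in L^2(\mathbb{R})=L^2(\mathbb{R},\mathbb{C})$ and $\phi\in\mathbb{R}$ define $f_\phi\in L^2(\mathbb{R})$ by $f_\phi(w)=f(w)$ if $\phi\equiv 0 \bmod 2\pi$, $f_\phi(w)=f(-w)$ if $\phi\equiv\pi\bmod 2\pi$, and $$f_\phi(w)=|\sin\phi|^{-1/2}\int_{\mathbb{R}} e\!\left[\frac{\frac12(w^2+w'^2)\cos\phi-ww'}{\sin\phi}\right] f(w')\,dw'\qquad(\phi\not\equiv 0\bmod\pi),$$ where for $f\in L^2(\mathbb{R})$ the integral is understood as the $L^2$-extension (via the Fourier transform on $L^2(\mathbb{R})$) of the integral operator from $L^1\cap L^2$. For $\tau=u+\mathrm{i}v$ with $v>0$ and $\xi=(x,y)$ put $$\Theta_f(\tau,\phi;\xi)=v^{1/4}\sum_{n\in\mathbb{Z}} f_\phi\big((n-y)v^{1/2}\big)\,e\big(\tfrac12(n-y)^2u+nx\big),$$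 the series being taken in $L^2$ of the unit square $[0,1)^2\ni\xi$; $|\Theta_f(\tau,\phi;\cdot)|$ is $\mathbb{Z}^2$-periodic and is regarded as a function on $\mathbb{T}^2$. Write $\Theta_f(M;\xi)=\Theta_f(\tau,\phi;\xi)$ for $M\in G$ with Iwasawa decomposition $$M=\begin{pmatrix}1&u\\0&1\end{pmatrix}\begin{pmatrix}v^{1/2}&0\\0&v^{-1/2}\end{pmatrix}\begin{pmatrix}\cos\phi&-\sin\phi\\ \sin\phi&\cos\phi\end{pmatrix}.$$ Theorem. Let $f\in L^2(\mathbb{R})$ and let $F:\mathbb{C}\to\mathbb{R}$ be bounded and continuous. Then, for all $\tau$ and $\phi$, the series defining $\Theta_f(\tau,\phi;\cdot)$ converges unconditionally in $L^2([0,1)^2)$, and $$\nu_f[F](M)=\int_{\mathbb{T}^3}F\big(e(t)\,|\Theta_f(M;\xi)|\big)\,dt\,d\xi$$ depends only on the coset $\Gamma M$ and defines a bounded continuous function $\nu_f[F]:\Gamma\backslash G\to\mathbb{R}$. -/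

import Mathlib

open MeasureTheory
open scoped ENNReal MatrixGroups

noncomputable section

namespace ThetaSum

/-- `e(x) = exp(2πix)`. -/
def e (x : ℝ) : ℂ := Complex.exp (2 * Real.pi * x * Complex.I)

lemma norm_e (x : ℝ) : ‖e x‖ = 1 := by
  have h : (2 * Real.pi * x * Complex.I : ℂ) = ((2 * Real.pi * x : ℝ) : ℂ) * Complex.I := by
    push_cast; ring
  rw [e, h, Complex.norm_exp_ofReal_mul_I]

lemma e_add (x y : ℝ) : e (x + y) = e x * e y := by
  rw [e, e, e, ← Complex.exp_add]; congr 1; push_cast; ring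

lemma continuous_e : Continuous e := by
  unfold e; fun_prop

lemma memLp_e_mul {α : Type*} [TopologicalSpace α] [MeasurableSpace α] [OpensMeasurableSpace α]
    {μ : Measure α} {g : α → ℝ} (hg : Continuous g)
    {f : α → ℂ} (hf : MemLp f 2 μ) : MemLp (fun w => e (g w) * f w) 2 μ := by
  refine hf.of_le ?_ (Filter.Eventually.of_forall fun w => by simp [norm_e])
  have h : Measurable (fun w => e (g w)) := (continuous_e.comp hg).measurable
  exact h.aestronglyMeasurable.mul hf.1

lemma quasi_affine {a : ℝ} (ha : a ≠ 0) (b : ℝ) :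
    Measure.map (fun y : ℝ => a * y + b) volume = ENNReal.ofReal |a⁻¹| • volume := by
  have h : (fun y : ℝ => a * y + b) = (fun y => y + b) ∘ (fun y => a * y) := rfl
  rw [h, ← Measure.map_map (by fun_prop) (by fun_prop), Real.map_volume_mul_left ha,
    Measure.map_smul, map_add_right_eq_self]

lemma memLp_affine {f : ℝ → ℂ} (hf : MemLp f 2 volume) {a : ℝ} (ha : a ≠ 0) (b : ℝ) :
    MemLp (fun y => f (a * y + b)) 2 volume := by
  refine MemLp.comp_of_map (g := f) (f := fun y : ℝ => a * y + b) ?_ (by fun_prop)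
  rw [quasi_affine ha]
  exact hf.smul_measure ENNReal.ofReal_ne_top

/-- Multiplication of an `L²` function by the chirp `w ↦ e(½ c w²)`. -/
def chirp (c : ℝ) (f : Lp ℂ 2 (volume : Measure ℝ)) : Lp ℂ 2 (volume : Measure ℝ) :=
  (memLp_e_mul (g := fun w => (1 / 2) * c * w ^ 2) (by fun_prop) (Lp.memLp f)).toLp

open Classical in
/-- The function `f_φ` attached to `f ∈ L²(ℝ)` (a representative of its class).  For `φ ∉ πℤ` the
oscillatory integral `|sin φ|^{-1/2} ∫ e[(½(w²+w'²)cos φ - w w')/sin φ] f(w') dw'` is understood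
in the `L²` sense: the exponential is expanded as
`e(½ cot φ w²) · e(½ cot φ w'²) · e(-(w / sin φ) w')`
and the integral against `e(-(w / sin φ) w')` is the Fourier transform on `L²(ℝ)`.
See `rot_eq_integral` for the agreement with the integral when `f` is integrable. -/
def rot (φ : ℝ) (f : Lp ℂ 2 (volume : Measure ℝ)) : ℝ → ℂ :=
  if (φ : Real.Angle) = 0 then fun w => f w
  else if (φ : Real.Angle) = (Real.pi : ℝ) then fun w => f (-w)
  else fun w => ((|Real.sin φ| ^ (-(1 / 2) : ℝ) : ℝ) : ℂ) *
    (e ((1 / 2) * (Real.cos φ / Real.sin φ) * w ^ 2) *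
      (FourierTransform.fourier (chirp (Real.cos φ / Real.sin φ) f) :
        Lp ℂ 2 (volume : Measure ℝ)) (w / Real.sin φ))

lemma sin_ne_zero_iff (φ : ℝ) : Real.sin φ ≠ 0 ↔
    (φ : Real.Angle) ≠ 0 ∧ (φ : Real.Angle) ≠ (Real.pi : ℝ) := by
  rw [← Real.Angle.sin_coe, Ne, Real.Angle.sin_eq_zero_iff, not_or]

lemma memLp_rot (φ : ℝ) (f : Lp ℂ 2 (volume : Measure ℝ)) : MemLp (rot φ f) 2 volume := by
  unfold rot
  split_ifs with h0 h1
  · exact Lp.memLp f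
  · simpa using memLp_affine (Lp.memLp f) (a := -1) (by norm_num) 0
  · have hs : Real.sin φ ≠ 0 := (sin_ne_zero_iff φ).2 ⟨h0, h1⟩
    refine MemLp.const_mul (memLp_e_mul (by fun_prop) ?_) _
    have := memLp_affine (Lp.memLp (FourierTransform.fourier
      (chirp (Real.cos φ / Real.sin φ) f) : Lp ℂ 2 (volume : Measure ℝ))) (inv_ne_zero hs) 0
    simpa [div_eq_inv_mul] using this

/-- On integrable functions, the Fourier transform on `L²(ℝ)` is the Fourier integral. -/
lemma fourier_ae_eq (h : Lp ℂ 2 (volume : Measure ℝ)) (hi : Integrable h) :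
    (FourierTransform.fourier h : Lp ℂ 2 (volume : Measure ℝ)) =ᵐ[volume]
      fun w => ∫ w' : ℝ, e (-(w' * w)) * h w' := by
  have hF : (fun w => ∫ w' : ℝ, e (-(w' * w)) * h w') =
      FourierTransform.fourier (h : ℝ → ℂ) := by
    funext w
    rw [Real.fourier_eq']
    congr 1; funext w'
    simp only [e, smul_eq_mul]
    congr 2
    simp
    ring
  rw [hF]
  refine ae_eq_of_integral_contDiff_smul_eq
    ((Lp.memLp _).locallyIntegrable (by norm_num)) ?_ ?_
  · have : Continuous (FourierTransform.fourier (h : ℝ → ℂ)) :=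
      VectorFourier.fourierIntegral_continuous Real.continuous_fourierChar
        (by exact continuous_inner) hi
    exact this.locallyIntegrable
  · intro g hg hgs
    have hg' : ContDiff ℝ ((⊤ : ℕ∞) : WithTop ℕ∞) (fun x => (g x : ℂ)) := Complex.ofRealCLM.contDiff.comp hg
    have hgs' : HasCompactSupport (fun x => (g x : ℂ)) :=
      hgs.comp_left (g := fun x : ℝ => (x : ℂ)) Complex.ofReal_zero
    let G : SchwartzMap ℝ ℂ := hgs'.toSchwartzMap hg'
    have h1 := congrArg (fun T : TemperedDistribution ℝ ℂ => T G)
      (Lp.fourier_toTemperedDistribution_eq h)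
    simp only [TemperedDistribution.fourier_apply, Lp.toTemperedDistribution_apply] at h1
    have h2 := VectorFourier.integral_fourierIntegral_smul_eq_flip (L := innerₗ ℝ)
      (μ := volume) (ν := volume) (f := (G : ℝ → ℂ)) (g := (h : ℝ → ℂ))
      Real.continuous_fourierChar (by exact continuous_inner) G.integrable hi
    have h3 : ∀ x, G x = (g x : ℂ) := fun x => rfl
    simp only [flip_innerₗ, h3] at h2
    calc ∫ x, g x • (FourierTransform.fourier h : Lp ℂ 2 (volume : Measure ℝ)) x
        = ∫ x, G x • (FourierTransform.fourier h : Lp ℂ 2 (volume : Measure ℝ)) x := by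
          simp [h3]
      _ = ∫ x, (FourierTransform.fourier G) x • h x := h1.symm
      _ = _ := by
          rw [SchwartzMap.fourier_coe]
          exact h2.trans (by simp [Real.fourier_eq, VectorFourier.fourierIntegral])

/-- For integrable `f`, the function `f_φ` is given by the absolutely convergent integral. -/
lemma rot_eq_integral (φ : ℝ) (hφ : Real.sin φ ≠ 0) (f : Lp ℂ 2 (volume : Measure ℝ))
    (hf : Integrable f) :
    rot φ f =ᵐ[volume] fun w => ((|Real.sin φ| ^ (-(1 / 2) : ℝ) : ℝ) : ℂ) *
      ∫ w' : ℝ, e (((1 / 2) * (w ^ 2 + w' ^ 2) * Real.cos φ - w * w') / Real.sin φ) * f w' := by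
  obtain ⟨h0, h1⟩ := (sin_ne_zero_iff φ).1 hφ
  set c := Real.cos φ / Real.sin φ with hc
  have hch : chirp c f =ᵐ[volume] fun w => e ((1 / 2) * c * w ^ 2) * f w := MemLp.coeFn_toLp _
  have hci : Integrable (chirp c f) := by
    refine Integrable.congr (hf.mono ?_ (Filter.Eventually.of_forall fun w => ?_)) hch.symm
    · exact (memLp_e_mul (by fun_prop) (Lp.memLp f)).1
    · simp [norm_e]
  have hF := fourier_ae_eq (chirp c f) hci
  have hq : Measure.QuasiMeasurePreserving (fun w : ℝ => w / Real.sin φ) volume volume := by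
    refine ⟨by fun_prop, ?_⟩
    have := quasi_affine (inv_ne_zero hφ) 0
    simp only [add_zero, ← div_eq_inv_mul] at this
    rw [this]
    exact Measure.smul_absolutelyContinuous
  filter_upwards [hq.ae hF] with w hw
  simp only [rot, if_neg h0, if_neg h1]
  rw [← hc, hw, ← integral_const_mul]
  congr 1
  refine integral_congr_ae ?_
  filter_upwards [hch] with w' hw'
  rw [hw', ← mul_assoc, ← mul_assoc, ← e_add, ← e_add]
  congr 2
  rw [hc]
  field_simp
  ring

/-- The `n`-th term of the theta series, as a function of `ξ = (x, y)`. -/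
def termFun (f : Lp ℂ 2 (volume : Measure ℝ)) (τ : UpperHalfPlane) (φ : ℝ) (n : ℤ)
    (ξ : ℝ × ℝ) : ℂ :=
  ((τ.im ^ (1 / 4 : ℝ) : ℝ) : ℂ) *
    (e ((1 / 2) * ((n : ℝ) - ξ.2) ^ 2 * τ.re + n * ξ.1) *
      rot φ f (((n : ℝ) - ξ.2) * τ.im ^ (1 / 2 : ℝ)))

/-- Lebesgue measure on `𝕋 = ℝ/ℤ`, realised on the fundamental domain `[0,1)`. -/
def torus1 : Measure ℝ := volume.restrict (Set.Ico 0 1)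

instance : IsProbabilityMeasure torus1 := ⟨by simp [torus1]⟩

/-- Lebesgue measure on `𝕋²`, realised on the fundamental domain `[0,1)²`.  (The theta series is
1-periodic in `x`, and `y ↦ y + 1` multiplies it by `e(x)`, so `|Θ_f|` is `ℤ²`-periodic.) -/
def torus2 : Measure (ℝ × ℝ) := torus1.prod torus1

/-- Lebesgue measure on `𝕋³`, realised on the fundamental domain `[0,1)³`. -/
def torus3 : Measure (ℝ × (ℝ × ℝ)) := torus1.prod torus2

lemma memLp_termFun (f : Lp ℂ 2 (volume : Measure ℝ)) (τ : UpperHalfPlane) (φ : ℝ) (n : ℤ) :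
    MemLp (termFun f τ φ n) 2 torus2 := by
  unfold termFun
  refine MemLp.const_mul (memLp_e_mul (by fun_prop) ?_) _
  have hv : -(τ.im ^ (1 / 2 : ℝ)) ≠ 0 := neg_ne_zero.2 (Real.rpow_pos_of_pos τ.im_pos _).ne'
  have h := (memLp_affine (memLp_rot φ f) hv (n * τ.im ^ (1 / 2 : ℝ))).restrict (Set.Ico 0 1)
  have h2 := h.comp_snd torus1
  refine (memLp_congr_ae (Filter.Eventually.of_forall fun p => ?_)).1 h2
  exact congrArg (rot φ f) (by ring)

/-- The `n`-th term of the theta series as an element of `L²([0,1)²)`. -/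
def term (f : Lp ℂ 2 (volume : Measure ℝ)) (τ : UpperHalfPlane) (φ : ℝ) (n : ℤ) :
    Lp ℂ 2 torus2 :=
  (memLp_termFun f τ φ n).toLp

/-- The theta function `Θ_f(τ, φ; ·)` for `f ∈ L²(ℝ)`: the unconditional sum of the theta series in
`L²([0,1)²)`. -/
def Theta (f : Lp ℂ 2 (volume : Measure ℝ)) (τ : UpperHalfPlane) (φ : ℝ) : Lp ℂ 2 torus2 :=
  ∑' n : ℤ, term f τ φ n

/-- First Iwasawa coordinate `τ = u + iv` of `M ∈ SL(2,ℝ)`. -/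
def tau (M : SL(2, ℝ)) : UpperHalfPlane := M • UpperHalfPlane.I

/-- Second Iwasawa coordinate `φ` of `M ∈ SL(2,ℝ)` (only its class modulo `2π` matters). -/
def phi (M : SL(2, ℝ)) : ℝ := Complex.arg ((M 1 0 : ℝ) * Complex.I + (M 1 1 : ℝ))

lemma iwasawa (M : SL(2, ℝ)) : (M : Matrix (Fin 2) (Fin 2) ℝ) =
    !![1, (tau M).re; 0, 1] *
    !![(tau M).im ^ (1 / 2 : ℝ), 0; 0, (tau M).im ^ (-(1 / 2) : ℝ)] *
    !![Real.cos (phi M), -Real.sin (phi M); Real.sin (phi M), Real.cos (phi M)] := by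
  set c : ℝ := M 1 0 with hc
  set d : ℝ := M 1 1 with hd
  have hdet : M 0 0 * d - M 0 1 * c = 1 := by
    have := M.det_coe
    rwa [Matrix.det_fin_two] at this
  have hpos : 0 < c ^ 2 + d ^ 2 := by
    rcases eq_or_ne c 0 with h | h
    · rcases eq_or_ne d 0 with h' | h'
      · simp [h, h'] at hdet
      · positivity
    · positivity
  set r : ℝ := Real.sqrt (c ^ 2 + d ^ 2) with hr
  have hrpos : 0 < r := Real.sqrt_pos.2 hpos
  have hr2 : r ^ 2 = c ^ 2 + d ^ 2 := Real.sq_sqrt hpos.le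
  set z : ℂ := (c : ℝ) * Complex.I + (d : ℝ) with hz
  have hzn : ‖z‖ = r := by
    rw [Complex.norm_eq_sqrt_sq_add_sq, hr]; congr 1; simp [hz]; ring
  have hz0 : z ≠ 0 := by rw [← norm_pos_iff, hzn]; exact hrpos
  have hcos : Real.cos (phi M) = d / r := by
    rw [phi, Complex.cos_arg hz0, hzn]; simp [hz]
  have hsin : Real.sin (phi M) = c / r := by
    rw [phi, Complex.sin_arg, ← hc, ← hd, ← hz, hzn]; simp [hz]
  have htau : ((tau M : UpperHalfPlane) : ℂ) =
      ((M 0 0 : ℝ) * Complex.I + (M 0 1 : ℝ)) / z := by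
    rw [tau, UpperHalfPlane.specialLinearGroup_apply]; simp [hz, hc, hd]
  have him : (tau M).im = (r ^ 2)⁻¹ := by
    rw [← UpperHalfPlane.coe_im, htau, Complex.div_im, Complex.normSq_eq_norm_sq, hzn]
    simp [hz]; field_simp; linarith
  have hre : (tau M).re = (M 0 0 * c + M 0 1 * d) / r ^ 2 := by
    rw [← UpperHalfPlane.coe_re, htau, Complex.div_re, Complex.normSq_eq_norm_sq, hzn]
    simp [hz]; field_simp; ring
  have hv1 : (tau M).im ^ (1 / 2 : ℝ) = r⁻¹ := by
    rw [him, ← Real.sqrt_eq_rpow, Real.sqrt_inv, Real.sqrt_sq hrpos.le]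
  have hv2 : (tau M).im ^ (-(1 / 2) : ℝ) = r := by
    rw [Real.rpow_neg (tau M).im_pos.le, hv1, inv_inv]
  rw [hv1, hv2, hre, hcos, hsin]
  ext i j
  fin_cases i <;> fin_cases j <;> simp [Matrix.mul_apply, Fin.sum_univ_two]
  all_goals field_simp
  all_goals try rw [hr2]
  · linear_combination d * hdet
  · linear_combination (-c) * hdet
  · exact hc.symm
  · exact hd.symm

/-- `M ↦ ∫_{𝕋³} F(e(t)|Θ_f(M; ξ)|) dt dξ` as a function on `SL(2,ℝ)`. -/
def nu (f : Lp ℂ 2 (volume : Measure ℝ)) (F : ℂ → ℝ) (M : SL(2, ℝ)) : ℝ :=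
  ∫ p, F (e p.1 * (‖Theta f (tau M) (phi M) p.2‖ : ℝ)) ∂torus3

/-- `Γ = SL(2,ℤ)` as a subgroup of `SL(2,ℝ)`. -/
def Gam : Subgroup SL(2, ℝ) :=
  (Matrix.SpecialLinearGroup.map (n := Fin 2) (Int.castRingHom ℝ)).range

/-- The space `Γ\G` of cosets `ΓM`, with the quotient topology. -/
abbrev Quo : Type := Quotient (QuotientGroup.rightRel Gam)

end ThetaSum

end

/-! The Gaussians `x ↦ exp(πiτx² + 2πizx)`, with `τ ∈ ℍ` fixed and `z ∈ ℂ` varying, span a dense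
subspace of `L²(ℝ)`. Multiplication by chirps, dilations and the Fourier transform permute all
Gaussians, up to scalars, as `SL(2,ℝ)` acts on `ℍ × ℂ`; hence an isometry of `L²(ℝ)` that acts on
Gaussians in the same way as `M` is unique up to a phase. The operator `f ↦ v^{1/4} e(½uw²)
f_φ(v^{1/2}w)` is such an isometry `U` for the matrix with Iwasawa coordinates `(u + iv, φ)`, and
`Θ_f` is the Zak transform `∑ₙ e(nx) (U f)(n - y)`, whose terms are pairwise orthogonal with squared
norms adding up to `‖f‖²`, so that the series converges unconditionally.

The average defining `ν_f[F]` only sees the absolute value of its argument, so the phase is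
irrelevant and `U` may be replaced by the isometry read off from the Bruhat decomposition, which
depends on `M` strongly continuously where the lower left entry does not vanish. The generators
`T` and `S` of `SL(2,ℤ)` correspond, on the Zak side, to a shear and a quarter turn of the torus
composed with unimodular factors; for `S` this is checked on Gaussians, where it is the functional
equation of the Jacobi theta function. Finally `S`-invariance carries continuity to the matrices
with vanishing lower left entry. -/

open Complex Filter Topology
open UpperHalfPlane hiding I
open scoped FourierTransform

noncomputable section

namespace ThetaSum

lemma e_intCast (k : ℤ) : e k = 1 := by
  rw [e, ← Complex.exp_int_mul_two_pi_mul_I k]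
  congr 1
  push_cast
  ring

lemma conj_e (x : ℝ) : (starRingEnd ℂ) (e x) = e (-x) := by
  have h : e (-x) * e x = 1 := by
    rw [← e_add, neg_add_cancel, ← Int.cast_zero, e_intCast]
  rw [← inv_eq_conj (norm_e x), inv_eq_of_mul_eq_one_left h]

/-! ### Isometries given by weighted composition -/

section WeightedComposition

variable {α β : Type*} [MeasurableSpace α] [MeasurableSpace β] {μ : Measure α} {ν : Measure β}
  {w : α → ℂ} {σ : α → β}

/-- The condition on a weight `w` and a map `σ` under which `f ↦ w · (f ∘ σ)` is an isometry from
`L²(ν)` to `L²(μ)`. -/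
structure IsL2Weight (w : α → ℂ) (σ : α → β) (μ : Measure α) (ν : Measure β) : Prop where
  measurable_weight : Measurable w
  measurable_map : Measurable σ
  map_withDensity : (μ.withDensity fun x => ‖w x‖ₑ ^ 2).map σ = ν

namespace IsL2Weight

lemma of_norm_eq_one (hw : Measurable w) (hw_norm : ∀ x, ‖w x‖ = 1)
    (hσ : MeasurePreserving σ μ ν) : IsL2Weight w σ μ ν where
  measurable_weight := hw
  measurable_map := hσ.measurable
  map_withDensity := by
    have h_one : (fun x => ‖w x‖ₑ ^ 2) = 1 := by
      funext x
      rw [← ofReal_norm, hw_norm, ENNReal.ofReal_one, one_pow, Pi.one_apply]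
    rw [h_one, withDensity_one, hσ.map_eq]

variable (h : IsL2Weight w σ μ ν)
include h

lemma ae_mul_eq {f g : β → ℂ} (hfg : f =ᵐ[ν] g) :
    (fun x => w x * f (σ x)) =ᵐ[μ] fun x => w x * g (σ x) := by
  rw [← h.map_withDensity] at hfg
  have h_ae := ae_of_ae_map h.measurable_map.aemeasurable hfg
  rw [ae_withDensity_iff (h.measurable_weight.enorm.pow_const 2)] at h_ae
  filter_upwards [h_ae] with x hx
  rcases eq_or_ne (w x) 0 with hw | hw
  · rw [hw, zero_mul, zero_mul]
  · rw [hx (pow_ne_zero 2 (enorm_ne_zero.2 hw))]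

lemma eLpNorm_mul {f : β → ℂ} (hf : Measurable f) :
    eLpNorm (fun x => w x * f (σ x)) 2 μ = eLpNorm f 2 ν := by
  have hfσ : Measurable fun x => f (σ x) := hf.comp h.measurable_map
  rw [eLpNorm_eq_lintegral_rpow_enorm_toReal two_ne_zero ENNReal.ofNat_ne_top,
    eLpNorm_eq_lintegral_rpow_enorm_toReal two_ne_zero ENNReal.ofNat_ne_top, ← h.map_withDensity,
    lintegral_map (hf.enorm.pow_const _) h.measurable_map,
    lintegral_withDensity_eq_lintegral_mul _ (h.measurable_weight.enorm.pow_const 2)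
      (hfσ.enorm.pow_const _)]
  simp only [enorm_mul, ENNReal.toReal_ofNat, Pi.mul_apply, ENNReal.rpow_ofNat, mul_pow]

lemma memLp_mul (f : Lp ℂ 2 ν) : MemLp (fun x => w x * f (σ x)) 2 μ := by
  have hf := (Lp.stronglyMeasurable f).measurable
  refine ⟨(h.measurable_weight.mul (hf.comp h.measurable_map)).aestronglyMeasurable, ?_⟩
  rw [h.eLpNorm_mul hf]
  exact Lp.eLpNorm_lt_top f

omit h in
/-- The isometry `f ↦ w · (f ∘ σ)` from `L²(ν)` to `L²(μ)`. -/
def weightedComp (h : IsL2Weight w σ μ ν) : Lp ℂ 2 ν →ₗᵢ[ℂ] Lp ℂ 2 μ where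
  toFun f := (h.memLp_mul f).toLp
  map_add' f g := by
    rw [← MemLp.toLp_add, MemLp.toLp_eq_toLp_iff]
    filter_upwards [h.ae_mul_eq (Lp.coeFn_add f g)] with x hx
    rw [hx, Pi.add_apply, Pi.add_apply, mul_add]
  map_smul' c f := by
    rw [RingHom.id_apply, ← MemLp.toLp_const_smul, MemLp.toLp_eq_toLp_iff]
    filter_upwards [h.ae_mul_eq (Lp.coeFn_smul c f)] with x hx
    rw [hx, Pi.smul_apply, Pi.smul_apply, smul_eq_mul, smul_eq_mul, mul_left_comm]
  norm_map' f := by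
    change ‖(h.memLp_mul f).toLp‖ = ‖f‖
    rw [Lp.norm_toLp, h.eLpNorm_mul (Lp.stronglyMeasurable f).measurable, Lp.norm_def]

lemma coeFn_weightedComp {f : Lp ℂ 2 ν} {g : β → ℂ} (hfg : f =ᵐ[ν] g) :
    h.weightedComp f =ᵐ[μ] fun x => w x * g (σ x) :=
  (MemLp.coeFn_toLp (h.memLp_mul f)).trans (h.ae_mul_eq hfg)

end IsL2Weight

/-- The isometry `f ↦ e(g) · (f ∘ σ)` attached to a phase `g` and a measure preserving map `σ`. -/
def phaseComp (g : α → ℝ) (hg : Measurable g) (hσ : MeasurePreserving σ μ ν) :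
    Lp ℂ 2 ν →ₗᵢ[ℂ] Lp ℂ 2 μ :=
  (IsL2Weight.of_norm_eq_one (continuous_e.measurable.comp hg) (fun x => norm_e (g x))
    hσ).weightedComp

lemma coeFn_phaseComp {g : α → ℝ} (hg : Measurable g) (hσ : MeasurePreserving σ μ ν)
    {f : Lp ℂ 2 ν} {k : β → ℂ} (hf : f =ᵐ[ν] k) :
    phaseComp g hg hσ f =ᵐ[μ] fun x => e (g x) * k (σ x) :=
  IsL2Weight.coeFn_weightedComp _ hf

end WeightedComposition

/-- The Hilbert space `L²(ℝ)`. -/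
abbrev L2R : Type := Lp ℂ 2 (volume : Measure ℝ)

/-- Multiplication by the chirp `x ↦ e(½ s x²)` as an isometry of `L²(ℝ)`. -/
def chirpIsometry (s : ℝ) : L2R →ₗᵢ[ℂ] L2R :=
  phaseComp (fun x => 1 / 2 * s * x ^ 2) (by fun_prop) (MeasurePreserving.id volume)

lemma coeFn_chirpIsometry (s : ℝ) {f : L2R} {k : ℝ → ℂ} (hf : f =ᵐ[volume] k) :
    chirpIsometry s f =ᵐ[volume] fun x => e (1 / 2 * s * x ^ 2) * k x :=
  coeFn_phaseComp _ _ hf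

lemma chirp_eq_chirpIsometry (s : ℝ) (f : L2R) : chirp s f = chirpIsometry s f :=
  Lp.ext ((MemLp.coeFn_toLp _).trans (coeFn_chirpIsometry s EventuallyEq.rfl).symm)

lemma isL2Weight_dilation (t : ℝˣ) :
    IsL2Weight (fun _ => ((|(t : ℝ)| ^ (1 / 2 : ℝ) : ℝ) : ℂ)) (fun x => (t : ℝ) * x)
      volume volume where
  measurable_weight := measurable_const
  measurable_map := measurable_const_mul _
  map_withDensity := by
    have h_sq : ‖((|(t : ℝ)| ^ (1 / 2 : ℝ) : ℝ) : ℂ)‖ₑ ^ 2 = ENNReal.ofReal |(t : ℝ)| := by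
      rw [← ofReal_norm, ← ENNReal.ofReal_pow (norm_nonneg _), norm_real, Real.norm_eq_abs,
        sq_abs, ← Real.sqrt_eq_rpow, Real.sq_sqrt (abs_nonneg _)]
    rw [withDensity_const, h_sq, Measure.map_smul, Real.map_volume_mul_left t.ne_zero, smul_smul,
      ← ENNReal.ofReal_mul (abs_nonneg _), ← abs_mul, mul_inv_cancel₀ t.ne_zero, abs_one,
      ENNReal.ofReal_one, one_smul]

/-- The isometry `f ↦ |t|^{1/2} f(t ·)` of `L²(ℝ)`. -/
def dilation (t : ℝˣ) : L2R →ₗᵢ[ℂ] L2R := (isL2Weight_dilation t).weightedComp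

lemma coeFn_dilation (t : ℝˣ) {f : L2R} {k : ℝ → ℂ} (hf : f =ᵐ[volume] k) :
    dilation t f =ᵐ[volume] fun x => ((|(t : ℝ)| ^ (1 / 2 : ℝ) : ℝ) : ℂ) * k (t * x) :=
  IsL2Weight.coeFn_weightedComp _ hf

/-- The Fourier transform as an isometry of `L²(ℝ)`. -/
def fourierIsometry : L2R →ₗᵢ[ℂ] L2R := (Lp.fourierTransformₗᵢ ℝ ℂ).toLinearIsometry

lemma fourierIsometry_apply (f : L2R) : fourierIsometry f = 𝓕 f := rfl

/-! ### Gaussians -/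

/-- The Gaussian `x ↦ exp(πiτx² + 2πizx)`, square integrable for `τ` in the upper half-plane. -/
def gaussian (τ z : ℂ) (x : ℝ) : ℂ :=
  cexp (Real.pi * I * τ * x ^ 2 + 2 * Real.pi * I * z * x)

lemma continuous_gaussian (τ z : ℂ) : Continuous (gaussian τ z) := by
  unfold gaussian
  fun_prop

lemma integrable_gaussian (τ : ℍ) (z : ℂ) : Integrable (gaussian τ z) := by
  have h_re : (Real.pi * I * (τ : ℂ)).re < 0 := by
    simpa using mul_pos Real.pi_pos τ.im_pos
  refine (integrable_cexp_quadratic' h_re (2 * Real.pi * I * z) 0).congr (.of_forall fun x => ?_)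
  simp only [gaussian, add_zero]

lemma memLp_gaussian (τ : ℍ) (z : ℂ) : MemLp (gaussian τ z) 2 volume := by
  rw [memLp_two_iff_integrable_sq_norm (continuous_gaussian τ z).aestronglyMeasurable]
  have h_re : (2 * Real.pi * I * (τ : ℂ)).re < 0 := by
    simpa using mul_pos Real.two_pi_pos τ.im_pos
  refine (integrable_cexp_quadratic' h_re (4 * Real.pi * I * z) 0).norm.congr
    (.of_forall fun x => ?_)
  simp only [gaussian]
  rw [← norm_pow, ← Complex.exp_nat_mul]
  congr 2
  push_cast
  ring

/-- The Gaussian `gaussian τ z` as an element of `L²(ℝ)`. -/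
def gaussianLp (τ : ℍ) (z : ℂ) : L2R := (memLp_gaussian τ z).toLp

lemma coeFn_gaussianLp (τ : ℍ) (z : ℂ) : gaussianLp τ z =ᵐ[volume] gaussian τ z :=
  MemLp.coeFn_toLp _

lemma gaussianLp_ne_zero (τ : ℍ) (z : ℂ) : gaussianLp τ z ≠ 0 := by
  intro h_zero
  have h_ae : gaussian τ z =ᵐ[volume] fun _ => 0 := by
    filter_upwards [coeFn_gaussianLp τ z, Lp.coeFn_zero ℂ 2 volume] with x hx hx₀
    rw [← hx, h_zero, hx₀, Pi.zero_apply]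
  have h_eq := (continuous_gaussian τ z).ae_eq_iff_eq volume continuous_const |>.1 h_ae
  exact Complex.exp_ne_zero _ (congrFun h_eq 0)

lemma norm_gaussian_zero_le_one (τ : ℍ) (x : ℝ) : ‖gaussian τ 0 x‖ ≤ 1 := by
  rw [gaussian, Complex.norm_exp, Real.exp_le_one_iff]
  have h_nonneg : 0 ≤ Real.pi * τ.im * x ^ 2 := by have := τ.im_pos; positivity
  simpa [← ofReal_pow] using h_nonneg

lemma gaussian_ofReal (τ : ℂ) (w x : ℝ) : gaussian τ w x = e (x * w) * gaussian τ 0 x := by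
  rw [e, gaussian, gaussian, ← Complex.exp_add]
  congr 1
  push_cast
  ring

/- If `f` is orthogonal to all `gaussian τ w` with `w` real, then the Fourier transform of the
integrable function `conj (gaussian τ 0) * f` vanishes. -/
lemma eq_zero_of_inner_gaussianLp_eq_zero (τ : ℍ) {f : L2R}
    (hf : ∀ z, inner ℂ (gaussianLp τ z) f = 0) : f = 0 := by
  have h_meas : AEStronglyMeasurable (fun x => (starRingEnd ℂ) (gaussian τ 0 x) * f x) :=
    (continuous_conj.comp (continuous_gaussian τ 0)).aestronglyMeasurable.mul (Lp.memLp f).1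
  have h_memLp : MemLp (fun x => (starRingEnd ℂ) (gaussian τ 0 x) * f x) 2 volume := by
    refine (Lp.memLp f).of_le h_meas (.of_forall fun x => ?_)
    rw [norm_mul, RCLike.norm_conj]
    exact mul_le_of_le_one_left (norm_nonneg _) (norm_gaussian_zero_le_one τ x)
  have h_int : Integrable (fun x => (starRingEnd ℂ) (gaussian τ 0 x) * f x) :=
    (memLp_gaussian τ 0).star.integrable_mul (Lp.memLp f)
  have h_coe := h_memLp.coeFn_toLp
  have h_fourier : 𝓕 h_memLp.toLp = 0 := by
    refine Lp.ext ((fourier_ae_eq _ (h_int.congr h_coe.symm)).trans ?_)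
    filter_upwards [Lp.coeFn_zero ℂ 2 (volume : Measure ℝ)] with w hw
    rw [hw, Pi.zero_apply]
    refine Eq.trans ?_ ((L2.inner_def _ _).symm.trans (hf w))
    refine integral_congr_ae ?_
    filter_upwards [h_coe, coeFn_gaussianLp τ w] with x hx hg
    rw [hx, RCLike.inner_apply, hg, gaussian_ofReal, map_mul, conj_e, ← mul_assoc, mul_comm]
  have h_zero : h_memLp.toLp = 0 := by
    rwa [← fourierIsometry_apply, map_eq_zero_iff _ fourierIsometry.injective] at h_fourier
  refine Lp.ext ?_
  rw [h_zero] at h_coe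
  filter_upwards [h_coe, Lp.coeFn_zero ℂ 2 (volume : Measure ℝ)] with x hx hx₀
  rw [hx₀, Pi.zero_apply] at hx ⊢
  exact (mul_eq_zero.1 hx.symm).resolve_left
    ((map_ne_zero _).2 (Complex.exp_ne_zero _))

lemma topologicalClosure_span_gaussianLp (τ : ℍ) :
    (Submodule.span ℂ (Set.range (gaussianLp τ))).topologicalClosure = ⊤ := by
  rw [Submodule.topologicalClosure_eq_top_iff, Submodule.eq_bot_iff]
  exact fun f hf => eq_zero_of_inner_gaussianLp_eq_zero τ fun z =>
    Submodule.mem_orthogonal _ _ |>.1 hf _ (Submodule.subset_span (Set.mem_range_self z))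

lemma ext_gaussianLp {E : Type*} [NormedAddCommGroup E] [NormedSpace ℂ E] {U V : L2R →ₗᵢ[ℂ] E}
    (τ : ℍ) (h : ∀ z, U (gaussianLp τ z) = V (gaussianLp τ z)) : U = V := by
  have h_dense : Dense (Submodule.span ℂ (Set.range (gaussianLp τ)) : Set L2R) := by
    rw [Submodule.dense_iff_topologicalClosure_eq_top]
    exact topologicalClosure_span_gaussianLp τ
  have h_eq : U.toContinuousLinearMap = V.toContinuousLinearMap :=
    ContinuousLinearMap.ext_on h_dense (by rintro _ ⟨z, rfl⟩; exact h z)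
  exact LinearIsometry.toContinuousLinearMap_injective h_eq

/-! ### Metaplectic isometries -/

/-- The automorphy factor `cτ + d`. -/
def autFactor (M : SL(2, ℝ)) (τ : ℍ) : ℂ := M 1 0 * τ + M 1 1

lemma autFactor_ne_zero (M : SL(2, ℝ)) (τ : ℍ) : autFactor M τ ≠ 0 := denom_ne_zero M τ

lemma coe_smul_eq_div_autFactor (M : SL(2, ℝ)) (τ : ℍ) :
    ((M • τ : ℍ) : ℂ) = (M 0 0 * τ + M 0 1) / autFactor M τ :=
  coe_specialLinearGroup_apply M τ

lemma autFactor_mul (M N : SL(2, ℝ)) (τ : ℍ) :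
    autFactor (M * N) τ = autFactor M (N • τ) * autFactor N τ := by
  rw [autFactor.eq_1 M, coe_smul_eq_div_autFactor, add_mul, mul_assoc,
    div_mul_cancel₀ _ (autFactor_ne_zero N τ), autFactor, autFactor,
    Matrix.SpecialLinearGroup.coe_mul, Matrix.mul_apply, Matrix.mul_apply, Fin.sum_univ_two,
    Fin.sum_univ_two]
  push_cast
  ring

/-- The index factor `exp(-πi c z² / (cτ + d))` of the transformation law of Jacobi forms. -/
def indexFactor (M : SL(2, ℝ)) (τ : ℍ) (z : ℂ) : ℂ :=
  cexp (-(Real.pi * I * M 1 0 * z ^ 2 / autFactor M τ))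

lemma indexFactor_mul (M N : SL(2, ℝ)) (τ : ℍ) (z : ℂ) :
    indexFactor (M * N) τ z =
      indexFactor N τ z * indexFactor M (N • τ) (z / autFactor N τ) := by
  have hM := autFactor_ne_zero M (N • τ)
  have hN := autFactor_ne_zero N τ
  have h_det : (N 0 0 * N 1 1 - N 0 1 * N 1 0 : ℂ) = 1 := by
    exact_mod_cast (Matrix.det_fin_two _).symm.trans N.det_coe
  have h_entry : ((M * N) 1 0 : ℂ) = M 1 0 * N 0 0 + M 1 1 * N 1 0 := by
    simp [Matrix.mul_apply, Fin.sum_univ_two]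
  have h_factor : autFactor M (N • τ) * autFactor N τ =
      M 1 0 * (N 0 0 * τ + N 0 1) + M 1 1 * autFactor N τ := by
    rw [autFactor, coe_smul_eq_div_autFactor, add_mul, mul_assoc, div_mul_cancel₀ _ hN]
  rw [indexFactor, indexFactor, indexFactor, ← Complex.exp_add, autFactor_mul, h_entry]
  congr 1
  field_simp
  have hN_eq : autFactor N τ = N 1 0 * τ + N 1 1 := rfl
  linear_combination z ^ 2 * N 1 0 * h_factor - z ^ 2 * M 1 0 * h_det -
    z ^ 2 * M 1 0 * N 0 0 * hN_eq

/-- A linear isometry `U` of `L²(ℝ)` is metaplectic over `M ∈ SL(2,ℝ)` if, up to a factor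
independent of `z`, it maps the Gaussians with parameters `(τ, z)` to those with parameters
`M • (τ, z)`, for the action of `SL(2,ℝ)` on `ℍ × ℂ` in the theory of Jacobi forms. -/
def IsMetaplectic (M : SL(2, ℝ)) (U : L2R →ₗᵢ[ℂ] L2R) : Prop :=
  ∀ τ : ℍ, ∃ κ : ℂ, ∀ z : ℂ, U (gaussianLp τ z) =
    (κ * indexFactor M τ z) • gaussianLp (M • τ) (z / autFactor M τ)

lemma isMetaplectic_id : IsMetaplectic 1 LinearIsometry.id := fun τ => ⟨1, fun z => by
  simp [indexFactor, autFactor]⟩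

lemma IsMetaplectic.comp {M N : SL(2, ℝ)} {U V : L2R →ₗᵢ[ℂ] L2R} (hU : IsMetaplectic M U)
    (hV : IsMetaplectic N V) : IsMetaplectic (M * N) (U.comp V) := by
  intro τ
  obtain ⟨κ, hκ⟩ := hV τ
  obtain ⟨κ', hκ'⟩ := hU (N • τ)
  refine ⟨κ * κ', fun z => ?_⟩
  rw [LinearIsometry.coe_comp, Function.comp_apply, hκ, map_smul, hκ', smul_smul,
    indexFactor_mul, autFactor_mul, mul_smul M N τ, div_div, mul_comm (autFactor N τ),
    mul_mul_mul_comm]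

lemma IsMetaplectic.exists_eq_smul {M : SL(2, ℝ)} {U V : L2R →ₗᵢ[ℂ] L2R}
    (hU : IsMetaplectic M U) (hV : IsMetaplectic M V) :
    ∃ c : ℂ, ‖c‖ = 1 ∧ ∀ f, U f = c • V f := by
  obtain ⟨κ, hκ⟩ := hU UpperHalfPlane.I
  obtain ⟨κ', hκ'⟩ := hV UpperHalfPlane.I
  set τ := UpperHalfPlane.I
  have h_gaussian : ∀ z, κ' • U (gaussianLp τ z) = κ • V (gaussianLp τ z) := fun z => by
    rw [hκ, hκ', smul_smul, smul_smul, mul_left_comm]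
  have h_norm : ‖κ'‖ = ‖κ‖ := by
    have h := congrArg norm (h_gaussian 0)
    rw [norm_smul, norm_smul, U.norm_map, V.norm_map] at h
    exact mul_right_cancel₀ (norm_ne_zero_iff.2 (gaussianLp_ne_zero τ 0)) h
  have hκ'_ne : κ' ≠ 0 := fun h => by
    have h_zero := hκ' 0
    rw [h, zero_mul, zero_smul, map_eq_zero_iff V V.injective] at h_zero
    exact gaussianLp_ne_zero τ 0 h_zero
  have hc : ‖κ / κ'‖ = 1 := by
    rw [norm_div, h_norm, div_self (h_norm ▸ norm_ne_zero_iff.2 hκ'_ne)]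
  let W : L2R →ₗᵢ[ℂ] L2R :=
    { toLinearMap := (κ / κ') • V.toLinearMap
      norm_map' := fun f => by
        rw [LinearMap.smul_apply, norm_smul, hc, one_mul]
        exact V.norm_map f }
  have hUW : U = W := ext_gaussianLp τ fun z => by
    change _ = (κ / κ') • V (gaussianLp τ z)
    rw [div_eq_inv_mul, mul_smul, ← h_gaussian, smul_smul, inv_mul_cancel₀ hκ'_ne, one_smul]
  exact ⟨κ / κ', hc, fun f => congrArg (fun L : L2R →ₗᵢ[ℂ] L2R => L f) hUW⟩

/-- The unipotent matrix `(1 s; 0 1)`. -/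
def unipotent (s : ℝ) : SL(2, ℝ) := ⟨!![1, s; 0, 1], by simp⟩

/-- The diagonal matrix `diag(t, t⁻¹)`. -/
def diagonal (t : ℝˣ) : SL(2, ℝ) := ⟨!![(t : ℝ), 0; 0, (t : ℝ)⁻¹], by simp⟩

/-- The Weyl element `(0 -1; 1 0)`. -/
def weyl : SL(2, ℝ) := ⟨!![0, -1; 1, 0], by simp⟩

lemma gaussian_chirp (s : ℝ) (τ z : ℂ) (x : ℝ) :
    e (1 / 2 * s * x ^ 2) * gaussian τ z x = gaussian (τ + s) z x := by
  rw [e, gaussian, gaussian, ← Complex.exp_add]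
  congr 1
  push_cast
  ring

lemma gaussian_dilation (t : ℝ) (τ z : ℂ) (x : ℝ) :
    gaussian τ z (t * x) = gaussian (t ^ 2 * τ) (t * z) x := by
  rw [gaussian, gaussian]
  congr 1
  push_cast
  ring

lemma fourierIntegral_gaussian (τ : ℍ) (z : ℂ) (w : ℝ) :
    ∫ x : ℝ, e (-(x * w)) * gaussian τ z x =
      1 / (-I * τ) ^ (1 / 2 : ℂ) * cexp (-(Real.pi * I * z ^ 2 / τ)) *
        gaussian (-1 / τ) (z / τ) w := by
  have h_re : 0 < (-I * (τ : ℂ)).re := by simpa using τ.im_pos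
  have h := congrFun (fourier_gaussian_pi' h_re (I * z)) w
  rw [Real.fourier_eq'] at h
  have hτ := UpperHalfPlane.ne_zero τ
  refine Eq.trans (integral_congr_ae (.of_forall fun x => ?_)) (h.trans ?_)
  · simp only [gaussian, e, smul_eq_mul, ← Complex.exp_add]
    congr 1
    simp only [RCLike.inner_apply, Real.ringHom_apply]
    push_cast
    ring
  · rw [mul_assoc, gaussian, ← Complex.exp_add]
    congr 2
    field_simp
    linear_combination (w ^ 2 + I ^ 2 * z ^ 2) * I_sq

lemma isMetaplectic_chirpIsometry (s : ℝ) : IsMetaplectic (unipotent s) (chirpIsometry s) := by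
  refine fun τ => ⟨1, fun z => ?_⟩
  have h_smul : ((unipotent s • τ : ℍ) : ℂ) = τ + s := by
    rw [coe_smul_eq_div_autFactor]
    simp [autFactor, unipotent]
  have h_factors : 1 * indexFactor (unipotent s) τ z = 1 ∧ z / autFactor (unipotent s) τ = z := by
    simp [indexFactor, autFactor, unipotent]
  rw [h_factors.1, h_factors.2, one_smul]
  refine Lp.ext ?_
  filter_upwards [coeFn_chirpIsometry s (coeFn_gaussianLp τ z),
    coeFn_gaussianLp (unipotent s • τ) z] with x h₁ h₂
  rw [h₁, h₂, h_smul, gaussian_chirp]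

lemma isMetaplectic_dilation (t : ℝˣ) : IsMetaplectic (diagonal t) (dilation t) := by
  refine fun τ => ⟨(|(t : ℝ)| ^ (1 / 2 : ℝ) : ℝ), fun z => ?_⟩
  have h_smul : ((diagonal t • τ : ℍ) : ℂ) = t ^ 2 * τ := by
    rw [coe_smul_eq_div_autFactor]
    simp only [autFactor, diagonal, Matrix.of_apply, Matrix.cons_val', Matrix.cons_val_zero,
      Matrix.cons_val_one, Matrix.cons_val_fin_one, ofReal_zero, ofReal_inv, zero_mul, zero_add,
      add_zero, div_inv_eq_mul]
    ring
  have h_factors : indexFactor (diagonal t) τ z = 1 ∧ z / autFactor (diagonal t) τ = t * z := by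
    simp [indexFactor, autFactor, diagonal, mul_comm]
  rw [h_factors.1, h_factors.2, mul_one]
  refine Lp.ext ?_
  filter_upwards [coeFn_dilation t (coeFn_gaussianLp τ z), Lp.coeFn_smul
    ((|(t : ℝ)| ^ (1 / 2 : ℝ) : ℝ) : ℂ) (gaussianLp (diagonal t • τ) (t * z)),
    coeFn_gaussianLp (diagonal t • τ) (t * z)] with x h₁ h₂ h₃
  rw [h₁, h₂, Pi.smul_apply, h₃, h_smul, smul_eq_mul, gaussian_dilation]

lemma coe_weyl_smul (τ : ℍ) : ((weyl • τ : ℍ) : ℂ) = -1 / τ := by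
  rw [coe_smul_eq_div_autFactor]
  simp [autFactor, weyl]

lemma fourierIsometry_gaussianLp (τ : ℍ) (z : ℂ) : fourierIsometry (gaussianLp τ z) =
    (1 / (-I * τ) ^ (1 / 2 : ℂ) * cexp (-(Real.pi * I * z ^ 2 / τ))) •
      gaussianLp (weyl • τ) (z / τ) := by
  rw [fourierIsometry_apply]
  refine Lp.ext ?_
  have h_int : Integrable (gaussianLp τ z) :=
    (integrable_gaussian τ z).congr (coeFn_gaussianLp τ z).symm
  filter_upwards [fourier_ae_eq _ h_int, Lp.coeFn_smul
    (1 / (-I * τ) ^ (1 / 2 : ℂ) * cexp (-(Real.pi * I * z ^ 2 / τ)))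
    (gaussianLp (weyl • τ) (z / τ)), coeFn_gaussianLp (weyl • τ) (z / τ)] with w h₁ h₂ h₃
  rw [h₁, h₂, Pi.smul_apply, h₃, coe_weyl_smul, smul_eq_mul, ← fourierIntegral_gaussian]
  refine integral_congr_ae ?_
  filter_upwards [coeFn_gaussianLp τ z] with x hx
  rw [hx]

lemma isMetaplectic_fourierIsometry : IsMetaplectic weyl fourierIsometry := by
  refine fun τ => ⟨1 / (-I * τ) ^ (1 / 2 : ℂ), fun z => ?_⟩
  have h_factor : autFactor weyl τ = τ := by simp [autFactor, weyl]
  have h_index : indexFactor weyl τ z = cexp (-(Real.pi * I * z ^ 2 / τ)) := by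
    rw [indexFactor, h_factor]
    simp [weyl]
  rw [h_index, h_factor, fourierIsometry_gaussianLp]

/-- The rotation matrix `(cos φ, -sin φ; sin φ, cos φ)`. -/
def rotation (φ : ℝ) : SL(2, ℝ) :=
  ⟨!![Real.cos φ, -Real.sin φ; Real.sin φ, Real.cos φ], by
    simp [Matrix.det_fin_two, ← sq, Real.cos_sq_add_sin_sq]⟩

lemma rotation_eq_of_coe_eq {φ ψ : ℝ} (h : (φ : Real.Angle) = ψ) : rotation φ = rotation ψ := by
  have h_cos := congrArg Real.Angle.cos h
  have h_sin := congrArg Real.Angle.sin h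
  simp only [Real.Angle.cos_coe, Real.Angle.sin_coe] at h_cos h_sin
  exact Subtype.ext (by simp only [rotation, h_cos, h_sin])

lemma rotation_zero : rotation 0 = 1 := by
  ext i j
  fin_cases i <;> fin_cases j <;> simp [rotation]

lemma rotation_pi : rotation Real.pi = diagonal (-1) := by
  ext i j
  fin_cases i <;> fin_cases j <;> simp [rotation, diagonal]

lemma rotation_eq_unipotent_mul {φ : ℝ} (hφ : Real.sin φ ≠ 0) :
    rotation φ = unipotent (Real.cos φ / Real.sin φ) * (diagonal (Units.mk0 _ hφ)⁻¹ *
      (weyl * unipotent (Real.cos φ / Real.sin φ))) := by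
  refine Subtype.ext ?_
  simp only [Matrix.SpecialLinearGroup.coe_mul]
  simp only [rotation, unipotent, diagonal, weyl, Matrix.mul_fin_two, Units.val_inv_eq_inv_val,
    Units.val_mk0]
  congrm !![?_, ?_; ?_, ?_]
  all_goals field_simp
  · ring
  · linear_combination -(Real.sin φ) * Real.sin_sq_add_cos_sq φ
  · ring
  · ring

lemma exists_isMetaplectic_rot (φ : ℝ) : ∃ U : L2R →ₗᵢ[ℂ] L2R,
    IsMetaplectic (rotation φ) U ∧ ∀ f, U f =ᵐ[volume] rot φ f := by
  by_cases h_zero : (φ : Real.Angle) = 0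
  · refine ⟨LinearIsometry.id, ?_, fun f => ?_⟩
    · rw [rotation_eq_of_coe_eq (h_zero.trans Real.Angle.coe_zero.symm), rotation_zero]
      exact isMetaplectic_id
    · rw [rot, if_pos h_zero]
      rfl
  by_cases h_pi : (φ : Real.Angle) = Real.pi
  · refine ⟨dilation (-1), ?_, fun f => ?_⟩
    · rw [rotation_eq_of_coe_eq h_pi, rotation_pi]
      exact isMetaplectic_dilation (-1)
    · rw [rot, if_neg h_zero, if_pos h_pi]
      simpa using coeFn_dilation (-1) (f := f) EventuallyEq.rfl
  have hφ : Real.sin φ ≠ 0 := (sin_ne_zero_iff φ).2 ⟨h_zero, h_pi⟩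
  set c := Real.cos φ / Real.sin φ with hc
  refine ⟨(chirpIsometry c).comp ((dilation (Units.mk0 _ hφ)⁻¹).comp
    (fourierIsometry.comp (chirpIsometry c))), ?_, fun f => ?_⟩
  · rw [rotation_eq_unipotent_mul hφ]
    exact (isMetaplectic_chirpIsometry c).comp ((isMetaplectic_dilation _).comp
      (isMetaplectic_fourierIsometry.comp (isMetaplectic_chirpIsometry c)))
  · rw [rot, if_neg h_zero, if_neg h_pi, ← hc, chirp_eq_chirpIsometry, ← fourierIsometry_apply]
    refine (coeFn_chirpIsometry c (coeFn_dilation _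
      (f := fourierIsometry (chirpIsometry c f)) EventuallyEq.rfl)).trans
      (.of_forall fun w => ?_)
    simp only [Units.val_inv_eq_inv_val, Units.val_mk0, abs_inv,
      Real.inv_rpow (abs_nonneg (Real.sin φ)), Real.rpow_neg (abs_nonneg (Real.sin φ)),
      div_eq_inv_mul w]
    ring

/-- The matrix with Iwasawa coordinates `(τ, φ)`. -/
def iwasawaMatrix (τ : ℍ) (φ : ℝ) : SL(2, ℝ) :=
  unipotent τ.re *
    (diagonal (Units.mk0 _ (Real.rpow_pos_of_pos τ.im_pos (1 / 2)).ne') * rotation φ)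

lemma iwasawaMatrix_tau_phi (M : SL(2, ℝ)) : iwasawaMatrix (tau M) (phi M) = M := by
  refine Subtype.ext ?_
  rw [iwasawa M, Matrix.mul_assoc, Real.rpow_neg (tau M).im_pos.le]
  rfl

lemma exists_isMetaplectic_iwasawaMatrix (τ : ℍ) (φ : ℝ) : ∃ U : L2R →ₗᵢ[ℂ] L2R,
    IsMetaplectic (iwasawaMatrix τ φ) U ∧ ∀ f, U f =ᵐ[volume] fun w =>
      e (1 / 2 * τ.re * w ^ 2) * ((τ.im ^ (1 / 4 : ℝ) : ℝ) * rot φ f (τ.im ^ (1 / 2 : ℝ) * w)) := by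
  obtain ⟨R, hR, hR_rot⟩ := exists_isMetaplectic_rot φ
  refine ⟨_, (isMetaplectic_chirpIsometry _).comp ((isMetaplectic_dilation _).comp hR),
    fun f => ?_⟩
  have h_rpow : |τ.im ^ (1 / 2 : ℝ)| ^ (1 / 2 : ℝ) = τ.im ^ (1 / 4 : ℝ) := by
    rw [abs_of_nonneg (Real.rpow_nonneg τ.im_pos.le _), ← Real.rpow_mul τ.im_pos.le]
    norm_num
  have h := coeFn_chirpIsometry τ.re (coeFn_dilation
    (Units.mk0 _ (Real.rpow_pos_of_pos τ.im_pos (1 / 2)).ne') (hR_rot f))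
  rwa [Units.val_mk0, h_rpow] at h

lemma eq_bruhat {M : SL(2, ℝ)} (hM : M 1 0 ≠ 0) :
    M = unipotent ((M 0 0 + 1) / M 1 0) * (weyl * (unipotent (M 1 0) *
      (weyl * unipotent ((M 1 1 + 1) / M 1 0)))) := by
  have h_det : M 0 0 * M 1 1 - M 0 1 * M 1 0 = 1 := (Matrix.det_fin_two _).symm.trans M.det_coe
  refine Subtype.ext ((Matrix.eta_fin_two _).trans ?_)
  simp only [Matrix.SpecialLinearGroup.coe_mul]
  simp only [unipotent, weyl, Matrix.mul_fin_two]
  congrm !![?_, ?_; ?_, ?_]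
  all_goals field_simp
  · ring
  · linear_combination -(M 1 0) * h_det
  · ring
  · ring

/-- The isometry of `L²(ℝ)` read off from the Bruhat decomposition of a matrix with lower left
entry `c ≠ 0`; it is metaplectic over that matrix. -/
def bruhatIsometry (M : SL(2, ℝ)) : L2R →ₗᵢ[ℂ] L2R :=
  (chirpIsometry ((M 0 0 + 1) / M 1 0)).comp (fourierIsometry.comp
    ((chirpIsometry (M 1 0)).comp (fourierIsometry.comp (chirpIsometry ((M 1 1 + 1) / M 1 0)))))

lemma isMetaplectic_bruhatIsometry {M : SL(2, ℝ)} (hM : M 1 0 ≠ 0) :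
    IsMetaplectic M (bruhatIsometry M) := by
  have h := (isMetaplectic_chirpIsometry ((M 0 0 + 1) / M 1 0)).comp
    (isMetaplectic_fourierIsometry.comp ((isMetaplectic_chirpIsometry (M 1 0)).comp
      (isMetaplectic_fourierIsometry.comp (isMetaplectic_chirpIsometry ((M 1 1 + 1) / M 1 0)))))
  rwa [← eq_bruhat hM] at h

lemma tendsto_of_tendsto_inner {X E : Type*} [NormedAddCommGroup E] [InnerProductSpace ℂ E]
    {l : Filter X} {u : X → E} {v : E} (h_norm : ∀ x, ‖u x‖ = ‖v‖)
    (h_inner : Tendsto (fun x => inner ℂ v (u x)) l (𝓝 (inner ℂ v v))) :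
    Tendsto u l (𝓝 v) := by
  rw [tendsto_iff_norm_sub_tendsto_zero]
  have h_re : Tendsto (fun x => √(2 * ‖v‖ ^ 2 - 2 * (inner ℂ v (u x)).re)) l (𝓝 0) := by
    have h := (((Complex.continuous_re.tendsto _).comp h_inner).const_mul 2).const_sub (2 * ‖v‖ ^ 2)
    have h_self : (inner ℂ v v).re = ‖v‖ ^ 2 := inner_self_eq_norm_sq (𝕜 := ℂ) v
    rw [h_self, sub_self] at h
    simpa only [Real.sqrt_zero, Function.comp_apply] using h.sqrt
  refine h_re.congr fun x => ?_
  rw [norm_sub_rev, ← Real.sqrt_sq (norm_nonneg (v - u x)), norm_sub_sq (𝕜 := ℂ), h_norm]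
  congr 1
  simp only [RCLike.re_to_complex]
  ring

section StrongContinuity

variable {X E : Type*} [TopologicalSpace X]

lemma continuous_phaseComp [FirstCountableTopology X] {α β : Type*} [MeasurableSpace α]
    [MeasurableSpace β] {μ : Measure α} {ν : Measure β} {σ : α → β} {g : X → α → ℝ}
    (hg : ∀ s, Measurable (g s)) (hg_cont : ∀ x, Continuous fun s => g s x)
    (hσ : MeasurePreserving σ μ ν) (f : Lp ℂ 2 ν) :
    Continuous fun s => phaseComp (g s) (hg s) hσ f := by
  refine continuous_iff_continuousAt.2 fun s₀ => ?_
  refine tendsto_of_tendsto_inner (fun s => by rw [LinearIsometry.norm_map,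
    LinearIsometry.norm_map]) ?_
  have h_inner : ∀ s, inner ℂ (phaseComp (g s₀) (hg s₀) hσ f) (phaseComp (g s) (hg s) hσ f) =
      ∫ x, inner ℂ (e (g s₀ x) * f (σ x)) (e (g s x) * f (σ x)) ∂μ := fun s => by
    rw [L2.inner_def]
    refine integral_congr_ae ?_
    filter_upwards [coeFn_phaseComp (hg s₀) hσ (f := f) EventuallyEq.rfl,
      coeFn_phaseComp (hg s) hσ (f := f) EventuallyEq.rfl] with x h₀ h
    rw [h₀, h]
  have hfσ : MemLp (fun x => f (σ x)) 2 μ := (Lp.memLp f).comp_measurePreserving hσ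
  have h_meas : ∀ s, AEStronglyMeasurable (fun x => e (g s x) * f (σ x)) μ := fun s =>
    (continuous_e.measurable.comp (hg s)).aestronglyMeasurable.mul hfσ.1
  simp only [h_inner]
  refine (continuousAt_of_dominated (bound := fun x => ‖f (σ x)‖ ^ 2)
    (.of_forall fun s => (h_meas s₀).inner (h_meas s))
    (.of_forall fun s => .of_forall fun x => ?_) ?_ (.of_forall fun x => ?_)).tendsto
  · refine (norm_inner_le_norm _ _).trans_eq ?_
    rw [norm_mul, norm_mul, norm_e, norm_e, one_mul, sq]
  · exact (memLp_two_iff_integrable_sq_norm hfσ.1).1 hfσ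
  · exact (continuous_const.inner
      ((continuous_e.comp (hg_cont x)).mul continuous_const)).continuousAt

lemma continuous_linearIsometry_apply [NormedAddCommGroup E] [NormedSpace ℂ E]
    {T : X → E →ₗᵢ[ℂ] E} (hT : ∀ f, Continuous fun x => T x f) {h : X → E} (hh : Continuous h) :
    Continuous fun x => T x (h x) := by
  refine continuous_iff_continuousAt.2 fun x₀ => ?_
  have h_diff : Tendsto (fun x => T x (h x - h x₀)) (𝓝 x₀) (𝓝 0) := by
    rw [tendsto_zero_iff_norm_tendsto_zero]
    simp only [LinearIsometry.norm_map]
    exact tendsto_iff_norm_sub_tendsto_zero.1 (hh.tendsto x₀)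
  simpa [ContinuousAt, ← map_add] using h_diff.add ((hT (h x₀)).tendsto x₀)

lemma continuous_chirpIsometry_apply {s : X → ℝ} (hs : Continuous s) {h : X → L2R}
    (hh : Continuous h) : Continuous fun x => chirpIsometry (s x) (h x) :=
  continuous_linearIsometry_apply
    (fun f => (continuous_phaseComp (g := fun s x => 1 / 2 * s * x ^ 2) (fun _ => by fun_prop)
      (fun _ => by fun_prop) (MeasurePreserving.id volume) f).comp hs) hh

lemma continuous_bruhatIsometry (f : L2R) :
    Continuous fun M : {M : SL(2, ℝ) // M 1 0 ≠ 0} => bruhatIsometry M f := by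
  have h_coe : Continuous fun M : {M : SL(2, ℝ) // M 1 0 ≠ 0} => (M : SL(2, ℝ)) :=
    continuous_subtype_val
  have h_entry : ∀ i j, Continuous fun M : {M : SL(2, ℝ) // M 1 0 ≠ 0} => M.1 i j := fun i j =>
    (continuous_subtype_val.comp h_coe).matrix_elem i j
  have h_quot : ∀ i, Continuous fun M : {M : SL(2, ℝ) // M 1 0 ≠ 0} =>
      (M.1 i i + 1) / M.1 1 0 := fun i =>
    ((h_entry i i).add continuous_const).div (h_entry 1 0) fun M => M.2
  exact continuous_chirpIsometry_apply (h_quot 0) <| fourierIsometry.continuous.comp <|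
    continuous_chirpIsometry_apply (h_entry 1 0) <| fourierIsometry.continuous.comp <|
    continuous_chirpIsometry_apply (h_quot 1) continuous_const

end StrongContinuity

/-! ### The Zak transform -/

section Partition

variable {α ι E : Type*} [MeasurableSpace α] {μ : Measure α} [NormedAddCommGroup E] {p : ℝ≥0∞}

lemma norm_rpow_eq_integral (hp : p ≠ 0) (hp_top : p ≠ ∞) (f : Lp E p μ) :
    ‖f‖ ^ p.toReal = ∫ x, ‖f x‖ ^ p.toReal ∂μ := by
  rw [Lp.norm_def, (Lp.memLp f).eLpNorm_eq_integral_rpow_norm hp hp_top,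
    ENNReal.toReal_ofReal (by positivity), ← Real.rpow_mul (by positivity),
    inv_mul_cancel₀ (ENNReal.toReal_pos hp hp_top).ne', Real.rpow_one]

variable [Countable ι] [Fact (1 ≤ p)]

lemma ae_eq_of_hasSum {u : ι → Lp E p μ} {f : Lp E p μ} {v : ι → α → E} {g : α → E}
    (hf : HasSum u f) (huv : ∀ i, u i =ᵐ[μ] v i) (hg : ∀ᵐ x ∂μ, HasSum (fun i => v i x) (g x)) :
    f =ᵐ[μ] g := by
  obtain ⟨s, hs, h_tendsto⟩ := (tendstoInMeasure_of_tendsto_Lp hf).exists_seq_tendsto_ae'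
  have h_sum : ∀ᵐ x ∂μ, ∀ k : ℕ, (∑ i ∈ s k, u i : Lp E p μ) x = ∑ i ∈ s k, v i x := by
    refine ae_all_iff.2 fun k => ?_
    filter_upwards [Lp.coeFn_finsetSum (s k) u, ae_all_iff.2 huv] with x hx hv
    simp only [hx, Finset.sum_apply, hv]
  filter_upwards [h_tendsto, h_sum, hg] with x hx h_eq hgx
  simp only [h_eq] at hx
  exact tendsto_nhds_unique hx (hgx.comp hs)

variable {𝕜 : Type*} [NormedField 𝕜] [NormedSpace 𝕜 E] {s : ι → Set α}

lemma hasSum_norm_restrict_rpow (hs : ∀ i, MeasurableSet (s i))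
    (h_disj : Pairwise (Function.onFun Disjoint s)) (h_univ : ⋃ i, s i = Set.univ) (hp : p ≠ ∞)
    (f : Lp E p μ) : HasSum (fun i => ‖LpToLpRestrictCLM α E 𝕜 μ p (s i) f‖ ^ p.toReal)
      (‖f‖ ^ p.toReal) := by
  have hp_ne : p ≠ 0 := (zero_lt_one.trans_le Fact.out).ne'
  have h_int : Integrable (fun x => ‖f x‖ ^ p.toReal) μ :=
    (Lp.memLp f).integrable_norm_rpow hp_ne hp
  have h_sum := hasSum_integral_iUnion hs h_disj h_int.integrableOn
  rw [h_univ, setIntegral_univ, ← norm_rpow_eq_integral hp_ne hp] at h_sum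
  refine h_sum.congr_fun fun i => ?_
  rw [norm_rpow_eq_integral hp_ne hp]
  refine integral_congr_ae ?_
  filter_upwards [LpToLpRestrictCLM_coeFn 𝕜 (s i) f] with x hx
  rw [hx]

/-- Restriction to the cells `s i` of a countable measurable partition, as an isometry from `Lᵖ(μ)`
to the `ℓᵖ`-sum of the spaces `Lᵖ` of the cells. -/
def partitionIsometry (hs : ∀ i, MeasurableSet (s i))
    (h_disj : Pairwise (Function.onFun Disjoint s)) (h_univ : ⋃ i, s i = Set.univ) (hp : p ≠ ∞) :
    Lp E p μ →ₗᵢ[𝕜] lp (fun i => Lp E p (μ.restrict (s i))) p where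
  toFun f := ⟨fun i => LpToLpRestrictCLM α E 𝕜 μ p (s i) f,
    memℓp_gen (hasSum_norm_restrict_rpow hs h_disj h_univ hp f).summable⟩
  map_add' f g := lp.ext (funext fun i => map_add _ f g)
  map_smul' c f := lp.ext (funext fun i => map_smul _ c f)
  norm_map' f := by
    have hp_pos : 0 < p.toReal := ENNReal.toReal_pos (zero_lt_one.trans_le Fact.out).ne' hp
    refine Real.rpow_left_injOn hp_pos.ne' (norm_nonneg _) (norm_nonneg _) ?_
    exact (lp.hasSum_norm hp_pos _).unique
      (hasSum_norm_restrict_rpow (𝕜 := 𝕜) hs h_disj h_univ hp f)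

end Partition

lemma torus1_eq_Ioc : torus1 = volume.restrict (Set.Ioc 0 1) :=
  restrict_Ico_eq_restrict_Ioc

/-- The interval `(n - 1, n]`, written so that Mathlib's lemmas on translates of a fundamental
interval apply. -/
abbrev unitCell (n : ℤ) : Set ℝ := Set.Ioc (-1 + n) (-1 + n + 1)

lemma measurePreserving_sub_snd (n : ℤ) : MeasurePreserving (fun ξ : ℝ × ℝ => (n : ℝ) - ξ.2)
    torus2 (volume.restrict (unitCell n)) := by
  have h := (Measure.measurePreserving_sub_left (volume : Measure ℝ) (n : ℝ)).restrict_preimage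
    (measurableSet_Ioc (a := -1 + (n : ℝ)) (b := -1 + n + 1))
  have h_cell : (fun y : ℝ => (n : ℝ) - y) ⁻¹' unitCell n = Set.Ico 0 1 := by
    rw [unitCell, Set.preimage_const_sub_Ioc]
    congr 1 <;> ring
  rw [h_cell] at h
  exact h.comp measurePreserving_snd

/-- The contribution `(x, y) ↦ e(nx) g(n - y)` of a function `g` on the `n`-th unit cell to the
Zak transform. -/
def zakBlock (n : ℤ) : Lp ℂ 2 (volume.restrict (unitCell n)) →ₗᵢ[ℂ] Lp ℂ 2 torus2 :=
  phaseComp (fun ξ => n * ξ.1) (by fun_prop) (measurePreserving_sub_snd n)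

lemma coeFn_zakBlock (n : ℤ) {f : Lp ℂ 2 (volume.restrict (unitCell n))} {k : ℝ → ℂ}
    (hf : f =ᵐ[volume.restrict (unitCell n)] k) :
    zakBlock n f =ᵐ[torus2] fun ξ => e (n * ξ.1) * k (n - ξ.2) :=
  coeFn_phaseComp _ _ hf

lemma integral_e_int_mul {k : ℤ} (hk : k ≠ 0) : ∫ x, e (k * x) ∂torus1 = 0 := by
  rw [torus1_eq_Ioc, ← intervalIntegral.integral_of_le zero_le_one]
  have h_ne : (2 * Real.pi * I * k : ℂ) ≠ 0 :=
    mul_ne_zero two_pi_I_ne_zero (Int.cast_ne_zero.2 hk)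
  have h_e : ∀ x : ℝ, e (k * x) = cexp (2 * Real.pi * I * k * x) := fun x => by
    rw [e]
    congr 1
    push_cast
    ring
  have h_one : cexp (2 * Real.pi * I * k * (1 : ℝ)) = 1 := by
    rw [← h_e, mul_one, e_intCast]
  simp only [h_e]
  rw [integral_exp_mul_complex h_ne, h_one, ofReal_zero, mul_zero, Complex.exp_zero, sub_self,
    zero_div]

lemma orthogonalFamily_zakBlock :
    OrthogonalFamily ℂ (fun n => Lp ℂ 2 (volume.restrict (unitCell n))) zakBlock := by
  intro m n hmn f g
  have h_inner : inner ℂ (zakBlock m f) (zakBlock n g) =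
      ∫ ξ : ℝ × ℝ, e ((n - m : ℤ) * ξ.1) * ((starRingEnd ℂ) (f (m - ξ.2)) * g (n - ξ.2))
        ∂torus1.prod torus1 := by
    rw [L2.inner_def]
    refine integral_congr_ae ?_
    filter_upwards [coeFn_zakBlock m (f := f) .rfl, coeFn_zakBlock n (f := g) .rfl] with ξ hf hg
    have h_phase : e ((n - m : ℤ) * ξ.1) = e (n * ξ.1) * e (-(m * ξ.1)) := by
      rw [← e_add, Int.cast_sub, sub_mul, sub_eq_add_neg]
    rw [hf, hg, RCLike.inner_apply, map_mul, conj_e, h_phase]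
    ring
  rw [h_inner, integral_prod_mul (fun x => e ((n - m : ℤ) * x))
    fun y => (starRingEnd ℂ) (f (m - y)) * g (n - y),
    integral_e_int_mul (sub_ne_zero.2 hmn.symm), zero_mul]

/-- The Zak transform `g ↦ ∑ₙ e(nx) g(n - y)`, an isometry from `L²(ℝ)` to `L²` of the torus. -/
def zak : L2R →ₗᵢ[ℂ] Lp ℂ 2 torus2 :=
  orthogonalFamily_zakBlock.linearIsometry.comp
    (partitionIsometry (fun _ => measurableSet_Ioc) (Set.pairwise_disjoint_Ioc_add_intCast (-1))
      (iUnion_Ioc_add_intCast (-1)) ENNReal.ofNat_ne_top)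

/-- The `n`-th term `(x, y) ↦ e(nx) g(n - y)` of the Zak transform. -/
def zakTerm (n : ℤ) (g : L2R) : Lp ℂ 2 torus2 :=
  zakBlock n (LpToLpRestrictCLM ℝ ℂ ℂ volume 2 (unitCell n) g)

lemma coeFn_zakTerm (n : ℤ) {g : L2R} {k : ℝ → ℂ} (hg : g =ᵐ[volume] k) :
    zakTerm n g =ᵐ[torus2] fun ξ => e (n * ξ.1) * k (n - ξ.2) :=
  coeFn_zakBlock n ((LpToLpRestrictCLM_coeFn ℂ _ g).trans (ae_restrict_of_ae hg))

lemma hasSum_zak (g : L2R) : HasSum (fun n => zakTerm n g) (zak g) :=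
  orthogonalFamily_zakBlock.hasSum_linearIsometry (partitionIsometry (fun _ => measurableSet_Ioc)
    (Set.pairwise_disjoint_Ioc_add_intCast (-1)) (iUnion_Ioc_add_intCast (-1))
    ENNReal.ofNat_ne_top g)

lemma measurePreserving_toIocMod_add (c : ℝ) :
    MeasurePreserving (fun x => toIocMod zero_lt_one 0 (x + c)) torus1 torus1 := by
  have h_mk := AddCircle.measurePreserving_mk (1 : ℝ) 0
  have h_coe := (measurePreserving_subtype_coe (μa := (volume : Measure ℝ))
    (measurableSet_Ioc (a := (0 : ℝ)) (b := 0 + 1))).comp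
    (AddCircle.measurePreserving_equivIoc (1 : ℝ) (a := 0))
  rw [zero_add, ← torus1_eq_Ioc] at h_mk
  simp only [zero_add, ← torus1_eq_Ioc] at h_coe
  exact (h_coe.comp (measurePreserving_add_right volume (c : AddCircle (1 : ℝ)))).comp h_mk

lemma measurePreserving_shear : MeasurePreserving
    (fun ξ : ℝ × ℝ => (toIocMod zero_lt_one 0 (ξ.1 + (1 / 2 - ξ.2)), ξ.2)) torus2 torus2 := by
  have h_meas : Measurable fun x : ℝ => toIocMod zero_lt_one 0 x := by
    simpa only [add_zero] using (measurePreserving_toIocMod_add 0).measurable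
  have h := MeasurePreserving.skew_product (μa := torus1) (μb := torus1) (μc := torus1)
    (μd := torus1) (MeasurePreserving.id torus1)
    (g := fun y x => toIocMod zero_lt_one 0 (x + (1 / 2 - y))) (h_meas.comp (by fun_prop))
    (.of_forall fun y => (measurePreserving_toIocMod_add _).map_eq)
  exact (Measure.measurePreserving_swap.comp h).comp Measure.measurePreserving_swap

/-- The action of the parabolic element `(1 1; 0 1)` on the Zak side: the shear
`(x, y) ↦ (x - y + ½, y)` of the torus with the phase `½y²`. -/
def shearIsometry : Lp ℂ 2 torus2 →ₗᵢ[ℂ] Lp ℂ 2 torus2 :=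
  phaseComp (fun ξ => 1 / 2 * ξ.2 ^ 2) (by fun_prop) measurePreserving_shear

lemma coeFn_shearIsometry {k : ℝ × ℝ → ℂ} {f : Lp ℂ 2 torus2} (hf : f =ᵐ[torus2] k) :
    shearIsometry f =ᵐ[torus2] fun ξ =>
      e (1 / 2 * ξ.2 ^ 2) * k (toIocMod zero_lt_one 0 (ξ.1 + (1 / 2 - ξ.2)), ξ.2) :=
  coeFn_phaseComp _ _ hf

lemma e_shear (n : ℤ) (x y : ℝ) : e (n * x) * e (1 / 2 * 1 * (n - y) ^ 2) =
    e (1 / 2 * y ^ 2) * e (n * toIocMod zero_lt_one 0 (x + (1 / 2 - y))) := by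
  set k := toIocDiv (zero_lt_one' ℝ) 0 (x + (1 / 2 - y))
  have h_mod : toIocMod zero_lt_one 0 (x + (1 / 2 - y)) = x + (1 / 2 - y) - k := by
    rw [toIocMod, zsmul_one]
  obtain ⟨j, hj⟩ := Int.even_mul_pred_self n
  have hj_real : (n : ℝ) * (n - 1) = j + j := by exact_mod_cast hj
  have h_exponent : (n : ℝ) * x + 1 / 2 * 1 * (n - y) ^ 2 =
      1 / 2 * y ^ 2 + n * (x + (1 / 2 - y) - k) + (j + n * k : ℤ) := by
    push_cast
    linear_combination (1 / 2) * hj_real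
  rw [h_mod, ← e_add, h_exponent, e_add, e_add, e_intCast, mul_one]

lemma zak_chirpIsometry_one (g : L2R) : zak (chirpIsometry 1 g) = shearIsometry (zak g) := by
  have h_term : ∀ n, zakTerm n (chirpIsometry 1 g) = shearIsometry (zakTerm n g) := fun n => by
    refine Lp.ext ?_
    filter_upwards [coeFn_zakTerm n (coeFn_chirpIsometry 1 (f := g) .rfl),
      coeFn_shearIsometry (coeFn_zakTerm n (g := g) .rfl)] with ξ h h'
    rw [h, h', ← mul_assoc, ← mul_assoc, e_shear]
  refine (hasSum_zak (chirpIsometry 1 g)).unique ?_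
  simp only [h_term]
  exact (hasSum_zak g).mapL shearIsometry.toContinuousLinearMap

lemma measurePreserving_one_sub : MeasurePreserving (fun y : ℝ => 1 - y) torus1 torus1 := by
  have h := (Measure.measurePreserving_sub_left (volume : Measure ℝ) 1).restrict_preimage
    (measurableSet_Ioc (a := (0 : ℝ)) (b := 1))
  rwa [Set.preimage_const_sub_Ioc, sub_self, sub_zero, ← torus1_eq_Ioc] at h

/-- The action of the Weyl element on the Zak side: the quarter turn `(x, y) ↦ (1 - y, x)` of the
torus with the phase `xy`. -/
def quarterTurnIsometry : Lp ℂ 2 torus2 →ₗᵢ[ℂ] Lp ℂ 2 torus2 :=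
  phaseComp (fun ξ => ξ.1 * ξ.2) (by fun_prop)
    ((measurePreserving_one_sub.prod (MeasurePreserving.id torus1)).comp
      Measure.measurePreserving_swap)

lemma coeFn_quarterTurnIsometry {k : ℝ × ℝ → ℂ} {f : Lp ℂ 2 torus2} (hf : f =ᵐ[torus2] k) :
    quarterTurnIsometry f =ᵐ[torus2] fun ξ => e (ξ.1 * ξ.2) * k (1 - ξ.2, ξ.1) :=
  coeFn_phaseComp _ _ hf

lemma gaussian_int_sub (τ z : ℂ) (n : ℤ) (x y : ℝ) : e (n * x) * gaussian τ z (n - y) =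
    gaussian τ z (-y) * jacobiTheta₂_term n (x + z - y * τ) τ := by
  rw [e, gaussian, gaussian, jacobiTheta₂_term, ← Complex.exp_add, ← Complex.exp_add]
  congr 1
  push_cast
  ring

lemma zak_gaussianLp (τ : ℍ) (z : ℂ) : zak (gaussianLp τ z) =ᵐ[torus2] fun ξ =>
    gaussian τ z (-ξ.2) * jacobiTheta₂ (ξ.1 + z - ξ.2 * τ) τ := by
  refine ae_eq_of_hasSum (hasSum_zak _) (fun n => coeFn_zakTerm n (coeFn_gaussianLp τ z))
    (.of_forall fun ξ => ?_)
  simp only [gaussian_int_sub]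
  exact (hasSum_jacobiTheta₂_term _ τ.im_pos).mul_left _

lemma gaussian_mul_jacobiTheta₂ {τ : ℂ} (hτ : τ ≠ 0) (z : ℂ) (x y : ℝ) :
    gaussian τ z (-y) * jacobiTheta₂ (x + z - y * τ) τ =
      e (x * y) * (1 / (-I * τ) ^ (1 / 2 : ℂ) * cexp (-(Real.pi * I * z ^ 2 / τ)) *
        (gaussian (-1 / τ) (z / τ) (-x) *
          jacobiTheta₂ ((1 - y : ℝ) + z / τ - x * (-1 / τ)) (-1 / τ))) := by
  have h_arg : (1 - y : ℝ) + z / τ - x * (-1 / τ) = (x + z - y * τ) / τ + 1 := by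
    push_cast
    field_simp
    ring
  have h_exp : gaussian τ z (-y) * cexp (-Real.pi * I * (x + z - y * τ) ^ 2 / τ) =
      e (x * y) * cexp (-(Real.pi * I * z ^ 2 / τ)) * gaussian (-1 / τ) (z / τ) (-x) := by
    rw [e, gaussian, gaussian, ← Complex.exp_add, ← Complex.exp_add, ← Complex.exp_add]
    congr 1
    push_cast
    field_simp
    ring
  rw [h_arg, jacobiTheta₂_add_left, jacobiTheta₂_functional_equation]
  linear_combination 1 / (-I * τ) ^ (1 / 2 : ℂ) *
    jacobiTheta₂ ((x + z - y * τ) / τ) (-1 / τ) * h_exp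

lemma zak_eq_quarterTurnIsometry (g : L2R) :
    zak g = quarterTurnIsometry (zak (fourierIsometry g)) := by
  suffices zak = quarterTurnIsometry.comp (zak.comp fourierIsometry) from
    congrArg (fun L : L2R →ₗᵢ[ℂ] Lp ℂ 2 torus2 => L g) this
  refine ext_gaussianLp UpperHalfPlane.I fun z => Lp.ext ?_
  set τ := UpperHalfPlane.I
  rw [LinearIsometry.coe_comp, Function.comp_apply, LinearIsometry.coe_comp, Function.comp_apply,
    fourierIsometry_gaussianLp, map_smul]
  filter_upwards [zak_gaussianLp τ z, coeFn_quarterTurnIsometry ((Lp.coeFn_smul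
    (1 / (-I * τ) ^ (1 / 2 : ℂ) * cexp (-(Real.pi * I * z ^ 2 / τ))) _).trans
    ((zak_gaussianLp (weyl • τ) (z / τ)).const_smul _))] with ξ h h'
  rw [h, h', Pi.smul_apply, smul_eq_mul, coe_weyl_smul, gaussian_mul_jacobiTheta₂ τ.ne_zero]

lemma term_eq_zakTerm {f : L2R} {τ : ℍ} {φ : ℝ} {U : L2R →ₗᵢ[ℂ] L2R}
    (hU : U f =ᵐ[volume] fun w => e (1 / 2 * τ.re * w ^ 2) *
      ((τ.im ^ (1 / 4 : ℝ) : ℝ) * rot φ f (τ.im ^ (1 / 2 : ℝ) * w))) (n : ℤ) :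
    term f τ φ n = zakTerm n (U f) := by
  refine Lp.ext ?_
  filter_upwards [MemLp.coeFn_toLp (memLp_termFun f τ φ n), coeFn_zakTerm n hU] with ξ h h'
  rw [term, h, h', termFun, mul_comm (τ.im ^ (1 / 2 : ℝ)), add_comm (1 / 2 * _ * _), e_add,
    mul_right_comm (1 / 2 : ℝ)]
  ring

lemma exists_hasSum_term (τ : ℍ) (φ : ℝ) : ∃ U, IsMetaplectic (iwasawaMatrix τ φ) U ∧
    ∀ f, HasSum (term f τ φ) (zak (U f)) := by
  obtain ⟨U, hU, hU_coe⟩ := exists_isMetaplectic_iwasawaMatrix τ φ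
  refine ⟨U, hU, fun f => ?_⟩
  rw [funext (term_eq_zakTerm (hU_coe f))]
  exact hasSum_zak (U f)

/-! ### Averages over the torus -/

instance : IsProbabilityMeasure torus2 := by
  unfold torus2
  infer_instance

instance : IsProbabilityMeasure torus3 := by
  unfold torus3
  infer_instance

/-- The average of `F (e(t) |H(ξ)|)` over `(t, ξ) ∈ 𝕋³`; `nu f F M` is its value at
`H = Θ_f(M; ·)`. -/
def torusAverage (F : ℂ → ℝ) (H : Lp ℂ 2 torus2) : ℝ :=
  ∫ p, F (e p.1 * (‖H p.2‖ : ℝ)) ∂torus3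

section TorusAverage

variable {F : ℂ → ℝ}

lemma ae_torus3_of_ae_torus2 {P : ℝ × ℝ → Prop} (h : ∀ᵐ ξ ∂torus2, P ξ) :
    ∀ᵐ p ∂torus3, P p.2 :=
  (Measure.quasiMeasurePreserving_snd (μ := torus1) (ν := torus2)).ae h

lemma stronglyMeasurable_integrand (hF : Continuous F) (H : Lp ℂ 2 torus2) :
    StronglyMeasurable fun p : ℝ × (ℝ × ℝ) => F (e p.1 * (‖H p.2‖ : ℝ)) :=
  hF.comp_stronglyMeasurable <|
    (continuous_e.comp continuous_fst).stronglyMeasurable.mul <|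
    continuous_ofReal.comp_stronglyMeasurable
      ((Lp.stronglyMeasurable H).comp_measurable measurable_snd).norm

lemma torusAverage_phaseComp (hF : Continuous F) {g : ℝ × ℝ → ℝ} (hg : Measurable g)
    {σ : ℝ × ℝ → ℝ × ℝ} (hσ : MeasurePreserving σ torus2 torus2) (H : Lp ℂ 2 torus2) :
    torusAverage F (phaseComp g hg hσ H) = torusAverage F H := by
  have h_map : MeasurePreserving (Prod.map id σ) torus3 torus3 :=
    (MeasurePreserving.id torus1).prod hσ
  have h_integral := integral_map (μ := torus3) h_map.measurable.aemeasurable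
    (stronglyMeasurable_integrand hF H).aestronglyMeasurable
  rw [h_map.map_eq] at h_integral
  rw [torusAverage, torusAverage, h_integral]
  refine integral_congr_ae ?_
  filter_upwards [ae_torus3_of_ae_torus2 (coeFn_phaseComp hg hσ (f := H) .rfl)] with p hp
  rw [hp, norm_mul, norm_e, one_mul, Prod.map_fst, Prod.map_snd, id]

lemma torusAverage_smul {c : ℂ} (hc : ‖c‖ = 1) (H : Lp ℂ 2 torus2) :
    torusAverage F (c • H) = torusAverage F H := by
  refine integral_congr_ae ?_
  filter_upwards [ae_torus3_of_ae_torus2 (Lp.coeFn_smul c H)] with p hp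
  rw [hp, Pi.smul_apply, norm_smul, hc, one_mul]

lemma continuous_torusAverage (hF : Continuous F) {C : ℝ} (hC : ∀ z, |F z| ≤ C) :
    Continuous (torusAverage F) := by
  refine continuous_iff_continuousAt.2 fun H => tendsto_iff_seq_tendsto.2 fun u hu => ?_
  refine tendsto_of_subseq_tendsto fun ns hns => ?_
  obtain ⟨ms, -, hms⟩ := (tendstoInMeasure_of_tendsto_Lp (hu.comp hns)).exists_seq_tendsto_ae
  refine ⟨ms, tendsto_integral_of_dominated_convergence (fun _ => C)
    (fun i => (stronglyMeasurable_integrand hF _).aestronglyMeasurable) (integrable_const C)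
    (fun i => .of_forall fun p => hC _) ?_⟩
  filter_upwards [ae_torus3_of_ae_torus2 hms] with p hp
  exact (hF.tendsto _).comp
    (tendsto_const_nhds.mul ((continuous_ofReal.tendsto _).comp hp.norm))

end TorusAverage

lemma nu_eq_torusAverage_zak {M : SL(2, ℝ)} {U : L2R →ₗᵢ[ℂ] L2R} (hU : IsMetaplectic M U)
    (f : L2R) (F : ℂ → ℝ) : nu f F M = torusAverage F (zak (U f)) := by
  obtain ⟨V, hV, h_sum⟩ := exists_hasSum_term (tau M) (phi M)
  rw [iwasawaMatrix_tau_phi] at hV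
  obtain ⟨c, hc, hUV⟩ := hU.exists_eq_smul hV
  rw [hUV, map_smul, torusAverage_smul hc, ← (h_sum f).tsum_eq]
  rfl

lemma exists_isMetaplectic (M : SL(2, ℝ)) : ∃ U, IsMetaplectic M U := by
  obtain ⟨U, hU, -⟩ := exists_isMetaplectic_iwasawaMatrix (tau M) (phi M)
  exact ⟨U, iwasawaMatrix_tau_phi M ▸ hU⟩

lemma abs_nu_le (f : L2R) {F : ℂ → ℝ} {C : ℝ} (hC : ∀ z, |F z| ≤ C) (M : SL(2, ℝ)) :
    |nu f F M| ≤ C := by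
  have h := norm_integral_le_of_norm_le_const (μ := torus3)
    (f := fun p => F (e p.1 * (‖Theta f (tau M) (phi M) p.2‖ : ℝ))) (.of_forall fun p => hC _)
  rwa [probReal_univ, mul_one] at h

lemma map_intCast_S :
    Matrix.SpecialLinearGroup.map (Int.castRingHom ℝ) ModularGroup.S = weyl := by
  ext i j
  rw [Matrix.SpecialLinearGroup.map_apply_coe, ModularGroup.coe_S]
  fin_cases i <;> fin_cases j <;> simp [weyl]

lemma map_intCast_T :
    Matrix.SpecialLinearGroup.map (Int.castRingHom ℝ) ModularGroup.T = unipotent 1 := by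
  ext i j
  rw [Matrix.SpecialLinearGroup.map_apply_coe, ModularGroup.coe_T]
  fin_cases i <;> fin_cases j <;> simp [unipotent]

section Nu

variable (f : L2R) {F : ℂ → ℝ} (hF : Continuous F)
include hF

lemma nu_unipotent_one_mul (M : SL(2, ℝ)) : nu f F (unipotent 1 * M) = nu f F M := by
  obtain ⟨U, hU⟩ := exists_isMetaplectic M
  rw [nu_eq_torusAverage_zak hU, nu_eq_torusAverage_zak ((isMetaplectic_chirpIsometry 1).comp hU),
    LinearIsometry.coe_comp, Function.comp_apply, zak_chirpIsometry_one]
  exact torusAverage_phaseComp hF _ _ _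

lemma nu_weyl_mul (M : SL(2, ℝ)) : nu f F (weyl * M) = nu f F M := by
  obtain ⟨U, hU⟩ := exists_isMetaplectic M
  rw [nu_eq_torusAverage_zak hU, nu_eq_torusAverage_zak (isMetaplectic_fourierIsometry.comp hU),
    LinearIsometry.coe_comp, Function.comp_apply, zak_eq_quarterTurnIsometry (U f)]
  exact (torusAverage_phaseComp hF _ _ _).symm

lemma nu_mul_of_mem {γ : SL(2, ℝ)} (hγ : γ ∈ Gam) (M : SL(2, ℝ)) :
    nu f F (γ * M) = nu f F M := by
  obtain ⟨g, rfl⟩ := hγ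
  have hg : g ∈ Subgroup.closure {ModularGroup.S, ModularGroup.T} :=
    SpecialLinearGroup.SL2Z_generators ▸ Subgroup.mem_top g
  induction hg using Subgroup.closure_induction generalizing M with
  | mem x hx =>
    rcases hx with rfl | rfl
    · rw [map_intCast_S, nu_weyl_mul f hF]
    · rw [map_intCast_T, nu_unipotent_one_mul f hF]
  | one => rw [map_one, one_mul]
  | mul x y _ _ hx hy => rw [map_mul, mul_assoc, hx, hy]
  | inv x _ hx => rw [← hx, ← mul_assoc, ← map_mul, mul_inv_cancel, map_one, one_mul]

lemma nu_eq_of_rightRel {M N : SL(2, ℝ)} (h : QuotientGroup.rightRel Gam M N) :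
    nu f F M = nu f F N := by
  have h_mul := nu_mul_of_mem f hF (QuotientGroup.rightRel_apply.1 h) M
  rwa [inv_mul_cancel_right, eq_comm] at h_mul

variable {C : ℝ} (hC : ∀ z, |F z| ≤ C)
include hC

lemma continuousAt_nu_of_ne_zero {M : SL(2, ℝ)} (hM : M 1 0 ≠ 0) :
    ContinuousAt (nu f F) M := by
  have h_open : IsOpen {M : SL(2, ℝ) | M 1 0 ≠ 0} :=
    isOpen_ne_fun (Continuous.matrix_elem continuous_subtype_val 1 0) continuous_const
  have h : Continuous fun M : {M : SL(2, ℝ) // M 1 0 ≠ 0} => nu f F M := by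
    simp only [fun M : {M : SL(2, ℝ) // M 1 0 ≠ 0} =>
      nu_eq_torusAverage_zak (isMetaplectic_bruhatIsometry M.2) f F]
    exact (continuous_torusAverage hF hC).comp
      (zak.continuous.comp (continuous_bruhatIsometry f))
  exact (h_open.isOpenEmbedding_subtypeVal.continuousAt_iff (x := ⟨M, hM⟩)).1 h.continuousAt

lemma continuous_nu : Continuous (nu f F) := by
  refine continuous_iff_continuousAt.2 fun M => ?_
  rcases ne_or_eq (M 1 0) 0 with hM | hM
  · exact continuousAt_nu_of_ne_zero f hF hC hM
  have h_det : M 0 0 * M 1 1 = 1 := by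
    have h := (Matrix.det_fin_two _).symm.trans M.det_coe
    rwa [hM, mul_zero, sub_zero] at h
  have h_entry : (weyl * M) 1 0 = M 0 0 := by
    rw [Matrix.SpecialLinearGroup.coe_mul]
    simp [weyl, Matrix.mul_apply, Fin.sum_univ_two]
  have h_weyl : ContinuousAt (nu f F) (weyl * M) :=
    continuousAt_nu_of_ne_zero f hF hC (h_entry ▸ left_ne_zero_of_mul_eq_one h_det)
  exact (h_weyl.comp (f := (weyl * ·)) (continuous_const_mul weyl).continuousAt).congr
    (.of_forall fun N => nu_weyl_mul f hF N)

end Nu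

end ThetaSum

end

theorem mainTheorem3 (f : MeasureTheory.Lp ℂ 2 (MeasureTheory.volume : MeasureTheory.Measure ℝ))
    (F : ℂ → ℝ) (hF : Continuous F) (hFb : ∃ C : ℝ, ∀ z : ℂ, |F z| ≤ C) :
    (∀ (τ : UpperHalfPlane) (φ : ℝ), Summable (ThetaSum.term f τ φ)) ∧
    ∃ ν : BoundedContinuousFunction ThetaSum.Quo ℝ,
      ∀ M : Matrix.SpecialLinearGroup (Fin 2) ℝ,
        ν (Quotient.mk (QuotientGroup.rightRel ThetaSum.Gam) M) = ThetaSum.nu f F M := by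
  obtain ⟨C, hC⟩ := hFb
  refine ⟨fun τ φ => ?_, ?_⟩
  · obtain ⟨U, -, h_sum⟩ := ThetaSum.exists_hasSum_term τ φ
    exact (h_sum f).summable
  · have h_inv := fun M N => ThetaSum.nu_eq_of_rightRel f hF (M := M) (N := N)
    have h_bound : ∀ q, ‖Quotient.lift (ThetaSum.nu f F) h_inv q‖ ≤ C :=
      Quotient.ind (ThetaSum.abs_nu_le f hC)
    exact ⟨.ofNormedAddCommGroup (Quotient.lift (ThetaSum.nu f F) h_inv)
      ((ThetaSum.continuous_nu f hF hC).quotient_lift h_inv) C h_bound, fun M => rfl⟩
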